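/- Let $\mathbb{K}$ be a field of characteristic zero, $G$ an abelian group (written additively) and $\varepsilon:G\times G\to\mathbb{K}^\times$ an anti-symmetric bicharacter, i.e. $\varepsilon(g,h)\varepsilon(h,g)=1$, $\varepsilon(g,h+k)=\varepsilon(g,h)\varepsilon(g,k)$ and $\varepsilon(g+h,k)=\varepsilon(g,k)\varepsilon(h,k)$. Let $L=\bigoplus_{g\in G}L_g$ be a finite-dimensional color Lie algebra over $\mathbb{K}$: a $G$-graded vector space with a bilinear bracket such that $[L_g,L_h]\subseteq L_{g+h}$ and, for all homogeneous $a,b,c$ of degrees $|a|,|b|,|c|$, $$[a,b]=-\varepsilon(|a|,|b|)[b,a],\qquad \varepsilon(|c|,|a|)[a,[b,c]]+\varepsilon(|a|,|b|)[b,[c,a]]+\varepsilon(|b|,|c|)[c,[a,b]]=0 .$$ Let $\omega:L\times L\to\mathbb{K}$ be a scalar graded 2-cocycle of degree zero: a bilinear form with $\omega(L_g,L_h)=0$ if $g+h\neq0$ and, for all homogeneous $a,b,c$, $$\omega(a,b)=-\varepsilon(|a|,|b|)\,\omega(b,a),\qquad \varepsilon(|c|,|a|)\,\omega(a,[b,c])+\varepsilon(|a|,|b|)\,\omega(b,[c,a])+\varepsilon(|b|,|c|)\,\omega(c,[a,b])=0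 .$$ Let $U_\omega(L)$ be the quotient of the tensor algebra $T(L)$ by the two-sided ideal generated by the elements $a\otimes b-\varepsilon(|a|,|b|)\,b\otimes a-[a,b]-\omega(a,b)$ with $a,b\in L$ homogeneous, and let $U_\omega(L)_g$ be the image of the span of the tensors $a_1\otimes\cdots\otimes a_n$ ($n\ge0$) with $a_i\in L_{g_i}$ and $g_1+\cdots+g_n=g$. Then $U_\omega(L)=\bigoplus_{g\in G}U_\omega(L)_g$ is a $G$-graded algebra, and it is (two-sided) Noetherian: it is graded left and graded right Noetherian, i.e. every ascending chain of homogeneous left ideals, and every ascending chain of homogeneous right ideals, is stationary; moreover it is left and right Noetherian as an ungraded ring. -/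

import Mathlib

/-- An anti-symmetric bicharacter `ε : G × G → Kˣ` on an (additively written) abelian group. -/
structure IsAntiBicharacter {K G : Type*} [Field K] [AddCommGroup G] (ε : G → G → Kˣ) : Prop where
  mul_swap : ∀ g h, ε g h * ε h g = 1
  add_right : ∀ g h k, ε g (h + k) = ε g h * ε g k
  add_left : ∀ g h k, ε (g + h) k = ε g k * ε h k

/-- The structure of a `G`-graded `ε`-Lie algebra (color Lie algebra) on the `K`-vector space `L`:
a decomposition `L = ⨁ L_g` and a bilinear bracket that is graded, `ε`-skew-symmetric and
satisfies the `ε`-Jacobi identity. -/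
structure ColorLieAlgebra {K G : Type*} [Field K] [AddCommGroup G] [DecidableEq G]
    (ε : G → G → Kˣ) (L : Type*) [AddCommGroup L] [Module K L] where
  /-- the homogeneous component of degree `g` -/
  comp : G → Submodule K L
  isInternal : DirectSum.IsInternal comp
  bracket : L →ₗ[K] L →ₗ[K] L
  bracket_mem : ∀ {g h : G} {a b : L}, a ∈ comp g → b ∈ comp h → bracket a b ∈ comp (g + h)
  skew : ∀ {g h : G} {a b : L}, a ∈ comp g → b ∈ comp h →
    bracket a b = -((ε g h : K) • bracket b a)
  jacobi : ∀ {g h k : G} {a b c : L}, a ∈ comp g → b ∈ comp h → c ∈ comp k →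
    (ε k g : K) • bracket a (bracket b c) + (ε g h : K) • bracket b (bracket c a)
      + (ε h k : K) • bracket c (bracket a b) = 0

/-- Scalar graded 2-cocycles (of degree zero) of a color Lie algebra: `ε`-skew-symmetric bilinear
forms `L × L → K`, of degree zero for the grading of `K` concentrated in degree `0`, that satisfy
the cocycle identity. -/
structure ColorTwoCocycle {K G : Type*} [Field K] [AddCommGroup G] [DecidableEq G]
    {ε : G → G → Kˣ} {L : Type*} [AddCommGroup L] [Module K L] (𝔏 : ColorLieAlgebra ε L) where
  form : L →ₗ[K] L →ₗ[K] K
  degree_zero : ∀ {g h : G} {a b : L}, a ∈ 𝔏.comp g → b ∈ 𝔏.comp h → g + h ≠ 0 → form a b = 0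
  skew : ∀ {g h : G} {a b : L}, a ∈ 𝔏.comp g → b ∈ 𝔏.comp h →
    form a b = -((ε g h : K) * form b a)
  cocycle : ∀ {g h k : G} {a b c : L}, a ∈ 𝔏.comp g → b ∈ 𝔏.comp h → c ∈ 𝔏.comp k →
    (ε k g : K) * form a (𝔏.bracket b c) + (ε g h : K) * form b (𝔏.bracket c a)
      + (ε h k : K) * form c (𝔏.bracket a b) = 0

section GeneralizedEnveloping

variable {K G : Type*} [Field K] [AddCommGroup G] [DecidableEq G] {ε : G → G → Kˣ}
  {L : Type*} [AddCommGroup L] [Module K L]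

/-- The relations `a ⊗ b - ε(|a|,|b|) b ⊗ a - [a,b] - ω(a,b) = 0` for homogeneous `a`, `b`. -/
inductive GenEnvelopingRel (𝔏 : ColorLieAlgebra ε L) (ω : ColorTwoCocycle 𝔏) :
    TensorAlgebra K L → TensorAlgebra K L → Prop
  | mk {g h : G} {a b : L} (ha : a ∈ 𝔏.comp g) (hb : b ∈ 𝔏.comp h) :
      GenEnvelopingRel 𝔏 ω
        (TensorAlgebra.ι K a * TensorAlgebra.ι K b
          - (ε g h : K) • (TensorAlgebra.ι K b * TensorAlgebra.ι K a)
          - TensorAlgebra.ι K (𝔏.bracket a b)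
          - algebraMap K (TensorAlgebra K L) (ω.form a b))
        0

/-- The generalized enveloping algebra `U_ω(L)`: the quotient of the tensor algebra of `L` by the
two-sided ideal generated by the elements above. -/
abbrev GenEnveloping (𝔏 : ColorLieAlgebra ε L) (ω : ColorTwoCocycle 𝔏) : Type _ :=
  RingQuot (GenEnvelopingRel 𝔏 ω)

/-- The component of degree `g` of the tensor algebra of `L` for its `G`-grading: it is spanned by
the tensors `a₁ ⊗ ⋯ ⊗ aₙ`, `n ≥ 0`, with `aᵢ ∈ L_{gᵢ}` and `g₁ + ⋯ + gₙ = g`. -/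
def tensorGrading (𝔏 : ColorLieAlgebra ε L) (g : G) : Submodule K (TensorAlgebra K L) :=
  Submodule.span K {t | ∃ l : List (G × L), (∀ p ∈ l, p.2 ∈ 𝔏.comp p.1) ∧
    (l.map Prod.fst).sum = g ∧ t = (l.map fun p => TensorAlgebra.ι K p.2).prod}

/-- The component of degree `g` of `U_ω(L)`: the image of that of the tensor algebra. -/
def genEnvelopingGrading (𝔏 : ColorLieAlgebra ε L) (ω : ColorTwoCocycle 𝔏) (g : G) :
    Submodule K (GenEnveloping 𝔏 ω) :=
  (tensorGrading 𝔏 g).map (RingQuot.mkAlgHom K (GenEnvelopingRel 𝔏 ω)).toLinearMap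

end GeneralizedEnveloping

/-- Every ascending chain of homogeneous left ideals of the graded algebra `A` is stationary. -/
def IsGradedLeftNoetherian {K G A : Type*} [Field K] [AddCommGroup G] [DecidableEq G] [Ring A]
    [Algebra K A] (𝒜 : G → Submodule K A) [GradedAlgebra 𝒜] : Prop :=
  ∀ I : ℕ →o Submodule A A, (∀ n, (I n).IsHomogeneous 𝒜) → ∃ n, ∀ m, n ≤ m → I n = I m

/-- Every ascending chain of homogeneous right ideals of the graded algebra `A` is stationary. -/
def IsGradedRightNoetherian {K G A : Type*} [Field K] [AddCommGroup G] [DecidableEq G] [Ring A]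
    [Algebra K A] (𝒜 : G → Submodule K A) [GradedAlgebra 𝒜] : Prop :=
  ∀ I : ℕ →o Submodule Aᵐᵒᵖ A, (∀ n, (I n).IsHomogeneous 𝒜) → ∃ n, ∀ m, n ≤ m → I n = I m

/-!
A homogeneous basis `x₁, …, xₙ` of `L` generates `U_ω(L)`, and its members commute up to nonzero
scalars and terms of degree at most one. For each exponent vector, fix one product of the `xᵢ` in
some order. These monomials span `U_ω(L)`, and they multiply like commuting monomials up to nonzero
scalars and terms that are lower in the degree-lexicographic order. For a left ideal, the exponents
of the leading terms form an ideal of `ℕⁿ` that grows strictly with the left ideal, so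
Dickson's lemma gives the ascending chain condition. This works with a spanning family of monomials,
so it avoids the PBW theorem. Right ideals are left ideals of the opposite algebra, whose generators
commute in the same way.

The sum of the components `U_ω(L)_g` is direct because the degree can be read off algebraically:
`a ↦ a • g` for `a ∈ L_g` respects the defining relations, and so it extends to an algebra map
`U_ω(L) → U_ω(L)[G]` that sends each `u ∈ U_ω(L)_g` to `u • g`.
-/

section LeadingIndices

variable {K V ι : Type*} [Ring K] [AddCommGroup V] [Module K V] [Preorder ι]

variable (K) in
/-- The span of the members of the family `e` whose index is strictly below `i`. -/
def lowerSpan (e : ι → V) (i : ι) : Submodule K V :=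
  Submodule.span K (e '' Set.Iio i)

theorem lowerSpan_mono (e : ι → V) : Monotone (lowerSpan K e) :=
  fun _ _ h => Submodule.span_mono (Set.image_mono (Set.Iio_subset_Iio h))

/-- The leading indices of the elements of a submodule `W` with respect to the family `e`, which
generalize the leading exponents of Gröbner basis theory. Since `e` need not be linearly
independent, a vector can have several leading indices. -/
def leadingIndices (e : ι → V) (W : Submodule K V) : Set ι :=
  {i | ∃ f ∈ W, f - e i ∈ lowerSpan K e i}

theorem leadingIndices_mono (e : ι → V) {W W' : Submodule K V} (h : W ≤ W') :
    leadingIndices e W ⊆ leadingIndices e W' :=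
  fun _ ⟨f, hf, hfi⟩ => ⟨f, h hf, hfi⟩

theorem mem_leadingIndices_of_units_smul {e : ι → V} {W : Submodule K V} {i : ι} {f : V} {u : Kˣ}
    (hf : f ∈ W) (hfi : f - u • e i ∈ lowerSpan K e i) : i ∈ leadingIndices e W := by
  refine ⟨u⁻¹ • f, W.smul_of_tower_mem _ hf, ?_⟩
  simpa only [smul_sub, inv_smul_smul] using Submodule.smul_of_tower_mem _ u⁻¹ hfi

end LeadingIndices

section LeadingTerm

variable {K V ι : Type*} [AddCommGroup V] [LinearOrder ι] {e : ι → V}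

theorem exists_leading_term_of_mem_span [Ring K] [Module K V] {s : Set ι} {f : V}
    (hf : f ∈ Submodule.span K (e '' s)) (hf₀ : f ≠ 0) :
    ∃ i ∈ s, ∃ c : K, c ≠ 0 ∧ f - c • e i ∈ lowerSpan K e i := by
  obtain ⟨l, hls, rfl⟩ := (Finsupp.mem_span_image_iff_linearCombination K).1 hf
  have hl : l.support.Nonempty := by
    rw [Finsupp.support_nonempty_iff]
    rintro rfl
    exact hf₀ (map_zero _)
  obtain ⟨i, hi, hmax⟩ := l.support.exists_max_image id hl
  refine ⟨i, hls hi, l i, Finsupp.mem_support_iff.1 hi, ?_⟩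
  rw [Finsupp.linearCombination_apply, ← Finsupp.add_sum_erase l i _ hi, add_sub_cancel_left]
  refine Submodule.sum_mem _ fun j hj => Submodule.smul_mem _ _ (Submodule.subset_span ?_)
  rw [Finsupp.support_erase, Finset.mem_erase] at hj
  exact ⟨j, (hmax j hj.2).lt_of_ne hj.1, rfl⟩

theorem le_of_leadingIndices_subset [DivisionRing K] [Module K V] [WellFoundedLT ι]
    (he : Submodule.span K (Set.range e) = ⊤) {W W' : Submodule K V} (hW : W' ≤ W)
    (h : leadingIndices e W ⊆ leadingIndices e W') : W ≤ W' := by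
  have reduce : ∀ i, ∀ f ∈ W, ∀ c : K, c ≠ 0 → f - c • e i ∈ lowerSpan K e i → f ∈ W' := by
    intro i
    induction i using WellFoundedLT.induction with
    | ind i ih =>
    intro f hf c hc hfi
    obtain ⟨g, hg, hgi⟩ := h (mem_leadingIndices_of_units_smul (u := .mk0 c hc) hf hfi)
    suffices f - c • g ∈ W' by simpa using W'.add_mem this (W'.smul_mem c hg)
    have hmem : f - c • g ∈ W := W.sub_mem hf (W.smul_mem c (hW hg))
    have hlow : f - c • g ∈ lowerSpan K e i := by
      simpa [smul_sub] using sub_mem hfi (Submodule.smul_mem _ c hgi)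
    by_cases h₀ : f - c • g = 0
    · exact h₀ ▸ W'.zero_mem
    obtain ⟨j, hji, d, hd, hdj⟩ := exists_leading_term_of_mem_span hlow h₀
    exact ih j hji _ hmem d hd hdj
  intro f hf
  by_cases hf₀ : f = 0
  · exact hf₀ ▸ W'.zero_mem
  have hspan : f ∈ Submodule.span K (e '' Set.univ) := by simp [he]
  obtain ⟨i, -, c, hc, hi⟩ := exists_leading_term_of_mem_span hspan hf₀
  exact reduce i f hf c hc hi

end LeadingTerm

section TriangularFamily

variable {K A M : Type*} [Ring A]

variable (K) in
/-- A family `e` indexed by an ordered additive monoid multiplies like the monomials of a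
polynomial ring up to units of `K` and lower terms. -/
def IsMulTriangular [CommRing K] [Algebra K A] [Preorder M] [Add M] (e : M → A) : Prop :=
  ∀ i j, ∃ u : Kˣ, e i * e j - (u : K) • e (i + j) ∈ lowerSpan K e (i + j)

namespace IsMulTriangular

section CommRing

variable [CommRing K] [Algebra K A] [Preorder M] [AddMonoid M] [AddLeftStrictMono M] {e : M → A}

theorem mul_mem_lowerSpan (he : IsMulTriangular K e) (i : M) {j : M} {f : A}
    (hf : f ∈ lowerSpan K e j) : e i * f ∈ lowerSpan K e (i + j) := by
  suffices lowerSpan K e j ≤ (lowerSpan K e (i + j)).comap (LinearMap.mulLeft K (e i)) from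
    this hf
  refine Submodule.span_le.2 ?_
  rintro _ ⟨k, hk, rfl⟩
  have hlt : i + k < i + j := add_lt_add_right hk i
  have hik : e (i + k) ∈ lowerSpan K e (i + j) := Submodule.subset_span ⟨i + k, hlt, rfl⟩
  obtain ⟨u, hu⟩ := he i k
  simpa using add_mem (lowerSpan_mono e hlt.le hu) (Submodule.smul_mem _ (u : K) hik)

theorem add_mem_leadingIndices (he : IsMulTriangular K e) (I : Ideal A) (i : M) {j : M}
    (hj : j ∈ leadingIndices e (I.restrictScalars K)) :
    i + j ∈ leadingIndices e (I.restrictScalars K) := by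
  obtain ⟨f, hf, hfj⟩ := hj
  obtain ⟨u, hu⟩ := he i j
  refine mem_leadingIndices_of_units_smul (u := u) (I.mul_mem_left (e i) hf) ?_
  simpa [mul_sub, Units.smul_def] using add_mem (he.mul_mem_lowerSpan i hfj) hu

/-- The leading indices of a left ideal, as an ideal of the index monoid. -/
def leadingIdeal (he : IsMulTriangular K e) (I : Ideal A) : AddSemigroupIdeal M where
  carrier := leadingIndices e (I.restrictScalars K)
  vadd_mem' i _ hj := he.add_mem_leadingIndices I i hj

end CommRing

section Field

variable [Field K] [Algebra K A] [LinearOrder M] [AddMonoid M] [AddLeftStrictMono M] {e : M → A}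

theorem leadingIdeal_strictMono [WellFoundedLT M] (he : IsMulTriangular K e)
    (hspan : Submodule.span K (Set.range e) = ⊤) : StrictMono he.leadingIdeal := by
  intro I J hIJ
  refine lt_of_le_not_ge (leadingIndices_mono e hIJ.le) fun h => hIJ.not_ge ?_
  exact le_of_leadingIndices_subset (W := J.restrictScalars K) (W' := I.restrictScalars K)
    hspan hIJ.le h

theorem isNoetherianRing [WellFoundedLT M] [WellFoundedGT (AddSemigroupIdeal M)]
    (he : IsMulTriangular K e) (hspan : Submodule.span K (Set.range e) = ⊤) :
    IsNoetherianRing A :=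
  isNoetherian_iff'.2 (he.leadingIdeal_strictMono hspan).wellFoundedGT

end Field

end IsMulTriangular

end TriangularFamily

section WordSpan

variable {K A σ : Type*} [CommSemiring K] [Semiring A] [Algebra K A]

variable (K) in
/-- The span of the words of length less than `d` in the letters `x`; the strict inequality
makes it vanish for `d = 0`. -/
def wordSpan (x : σ → A) (d : ℕ) : Submodule K A :=
  Submodule.span K ((fun l : List σ => (l.map x).prod) '' {l | l.length < d})

theorem prod_mem_wordSpan (x : σ → A) {l : List σ} {d : ℕ} (h : l.length < d) :
    (l.map x).prod ∈ wordSpan K x d :=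
  Submodule.subset_span ⟨l, h, rfl⟩

theorem mul_mem_wordSpan {x : σ → A} {m n : ℕ} {a b : A} (ha : a ∈ wordSpan K x (m + 1))
    (hb : b ∈ wordSpan K x n) : a * b ∈ wordSpan K x (m + n) := by
  have h := Submodule.mul_mem_mul ha hb
  rw [wordSpan, wordSpan, Submodule.span_mul_span] at h
  refine Submodule.span_mono ?_ h
  rintro _ ⟨_, ⟨l, hl, rfl⟩, _, ⟨l', hl', rfl⟩, rfl⟩
  rw [Set.mem_ofPred_eq] at hl hl'
  exact ⟨l ++ l', by simp; lia, by simp⟩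

theorem span_insert_one_range_le_wordSpan (x : σ → A) :
    Submodule.span K (insert 1 (Set.range x)) ≤ wordSpan K x 2 := by
  refine Submodule.span_le.2 (Set.insert_subset ?_ (Set.range_subset_iff.2 fun i => ?_))
  · simpa using prod_mem_wordSpan (K := K) x (l := []) two_pos
  · simpa using prod_mem_wordSpan (K := K) x (l := [i]) one_lt_two

theorem iSup_wordSpan_eq_top {x : σ → A} (hx : Algebra.adjoin K (Set.range x) = ⊤) :
    ⨆ d, wordSpan K x d = ⊤ := by
  rw [eq_top_iff, ← Algebra.top_toSubmodule, ← hx, Algebra.adjoin_eq_span, Submodule.span_le]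
  intro a ha
  rw [SetLike.mem_coe, ← FreeMonoid.mrange_lift] at ha
  obtain ⟨l, rfl⟩ := ha
  rw [FreeMonoid.lift_apply]
  exact Submodule.mem_iSup_of_mem _ (prod_mem_wordSpan x (Nat.lt_succ_self l.toList.length))

end WordSpan

section SkewCommuting

variable {K A σ : Type*} [CommRing K] [Ring A] [Algebra K A]

variable (K) in
/-- The members of the family `x` commute up to units of `K` and terms of degree at most one in
`x`. -/
def IsSkewCommuting (x : σ → A) : Prop :=
  ∀ i j, ∃ u : Kˣ,
    x i * x j - (u : K) • (x j * x i) ∈ Submodule.span K (insert 1 (Set.range x))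

/-- The monomial with exponent vector `α` in the family `x`; the order of its factors is an
arbitrary choice. -/
noncomputable def stdMonomial {A : Type*} [Monoid A] (x : σ → A) (α : DegLex (σ →₀ ℕ)) : A :=
  ((Finsupp.toMultiset (ofDegLex α)).toList.map x).prod

theorem length_toList_toMultiset (α : σ →₀ ℕ) :
    (Finsupp.toMultiset α).toList.length = α.degree := by
  rw [Multiset.length_toList, Finsupp.card_toMultiset]
  rfl

namespace IsSkewCommuting

variable {x : σ → A}

theorem exists_sub_smul_mem_of_perm (hx : IsSkewCommuting K x) {l l' : List σ} (h : l.Perm l') :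
    ∃ u : Kˣ, (l.map x).prod - (u : K) • (l'.map x).prod ∈ wordSpan K x l.length := by
  induction h with
  | nil => exact ⟨1, by simp⟩
  | cons i _ ih =>
    obtain ⟨u, hu⟩ := ih
    have hi : x i ∈ wordSpan K x (1 + 1) :=
      span_insert_one_range_le_wordSpan x (Submodule.subset_span (.inr ⟨i, rfl⟩))
    exact ⟨u, by simpa [mul_sub, add_comm] using mul_mem_wordSpan hi hu⟩
  | swap i j l =>
    obtain ⟨u, hu⟩ := hx j i
    have hl := prod_mem_wordSpan (K := K) x l.length.lt_succ_self
    have := mul_mem_wordSpan (span_insert_one_range_le_wordSpan x hu) hl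
    exact ⟨u, by simpa [sub_mul, mul_assoc, add_comm] using this⟩
  | trans h₁ _ ih₁ ih₂ =>
    obtain ⟨u, hu⟩ := ih₁
    obtain ⟨v, hv⟩ := ih₂
    rw [← h₁.length_eq] at hv
    exact ⟨u * v, by simpa [smul_sub, smul_smul] using add_mem hu (Submodule.smul_mem _ (u : K) hv)⟩

theorem exists_sub_smul_stdMonomial_mem (hx : IsSkewCommuting K x) {l : List σ}
    {α : DegLex (σ →₀ ℕ)} (h : Finsupp.toMultiset (ofDegLex α) = l) :
    ∃ u : Kˣ, (l.map x).prod - (u : K) • stdMonomial x α ∈ wordSpan K x l.length :=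
  hx.exists_sub_smul_mem_of_perm (Multiset.coe_eq_coe.1 (by simp [h]))

theorem wordSpan_le (hx : IsSkewCommuting K x) (d : ℕ) :
    wordSpan K x d ≤ Submodule.span K (stdMonomial x '' {α | (ofDegLex α).degree < d}) := by
  classical
  induction d with
  | zero => simp [wordSpan]
  | succ d ih =>
    refine Submodule.span_le.2 ?_
    rintro _ ⟨l, hl, rfl⟩
    have hl : l.length < d + 1 := hl
    let α : DegLex (σ →₀ ℕ) := toDegLex (Multiset.toFinsupp (l : Multiset σ))
    have hα : Finsupp.toMultiset (ofDegLex α) = l := by simp [α]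
    have hdeg : (ofDegLex α).degree = l.length := by
      rw [← length_toList_toMultiset, hα, Multiset.length_toList, Multiset.coe_card]
    obtain ⟨u, hu⟩ := hx.exists_sub_smul_stdMonomial_mem hα
    have hshort : wordSpan K x l.length ≤ wordSpan K x d :=
      Submodule.span_mono (Set.image_mono fun _ h => lt_of_lt_of_le h (Nat.lt_succ_iff.1 hl))
    change (l.map x).prod ∈ _
    rw [← sub_add_cancel (l.map x).prod ((u : K) • stdMonomial x α)]
    refine add_mem ?_ (Submodule.smul_mem _ _ (Submodule.subset_span ⟨α, hdeg.trans_lt hl, rfl⟩))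
    exact Submodule.span_mono (Set.image_mono fun _ h => Nat.lt_succ_of_lt h) (ih (hshort hu))

theorem span_stdMonomial (hx : IsSkewCommuting K x)
    (hgen : Algebra.adjoin K (Set.range x) = ⊤) :
    Submodule.span K (Set.range (stdMonomial x)) = ⊤ := by
  rw [eq_top_iff, ← iSup_wordSpan_eq_top hgen]
  exact iSup_le fun d => (hx.wordSpan_le d).trans (Submodule.span_mono (Set.image_subset_range _ _))

theorem isMulTriangular_stdMonomial [LinearOrder σ] (hx : IsSkewCommuting K x) :
    IsMulTriangular K (stdMonomial x) := by
  intro α β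
  let l := (Finsupp.toMultiset (ofDegLex α)).toList ++ (Finsupp.toMultiset (ofDegLex β)).toList
  have hl : Finsupp.toMultiset (ofDegLex (α + β)) = l := by
    simp [l, ofDegLex_add, ← Multiset.coe_add]
  have hdeg : l.length = (ofDegLex (α + β)).degree := by
    rw [← length_toList_toMultiset, hl, Multiset.length_toList, Multiset.coe_card]
  have hlower : wordSpan K x l.length ≤ lowerSpan K (stdMonomial x) (α + β) :=
    (hx.wordSpan_le _).trans <| Submodule.span_mono <| Set.image_mono fun _ hγ =>
      Finsupp.DegLex.lt_iff.2 (.inl (lt_of_lt_of_eq hγ hdeg))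
  obtain ⟨u, hu⟩ := hx.exists_sub_smul_stdMonomial_mem hl
  exact ⟨u, by simpa [l, stdMonomial] using hlower hu⟩

theorem op (hx : IsSkewCommuting K x) :
    IsSkewCommuting K fun i => MulOpposite.op (x i) := by
  intro i j
  obtain ⟨u, hu⟩ := hx j i
  have := Submodule.mem_map_of_mem
    (f := (MulOpposite.opLinearEquiv K : A ≃ₗ[K] Aᵐᵒᵖ).toLinearMap) hu
  rw [Submodule.map_span, Set.image_insert_eq, ← Set.range_comp] at this
  exact ⟨u, by simpa [Function.comp_def] using this⟩

theorem isNoetherianRing {K : Type*} [Field K] [Algebra K A] [Finite σ]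
    (hx : IsSkewCommuting K x) (hgen : Algebra.adjoin K (Set.range x) = ⊤) :
    IsNoetherianRing A := by
  let : LinearOrder σ := LinearOrder.lift' (Finite.equivFin σ) (Finite.equivFin σ).injective
  have : WellFoundedGT (AddSemigroupIdeal (DegLex (σ →₀ ℕ))) :=
    inferInstanceAs (WellFoundedGT (AddSemigroupIdeal (σ →₀ ℕ)))
  exact hx.isMulTriangular_stdMonomial.isNoetherianRing (hx.span_stdMonomial hgen)

theorem isNoetherianRing_mulOpposite {K : Type*} [Field K] [Algebra K A] [Finite σ]
    (hx : IsSkewCommuting K x) (hgen : Algebra.adjoin K (Set.range x) = ⊤) :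
    IsNoetherianRing Aᵐᵒᵖ := by
  refine hx.op.isNoetherianRing ?_
  have hpre : (Set.range fun i => MulOpposite.op (x i)) = MulOpposite.unop ⁻¹' Set.range x := by
    ext a
    simp [← MulOpposite.unop_inj]
  rw [hpre, ← Subalgebra.op_adjoin, hgen, Subalgebra.op_top]

end IsSkewCommuting

end SkewCommuting

section GradedNoetherian

theorem isNoetherian_mulOpposite (R : Type*) [Semiring R] [IsNoetherianRing Rᵐᵒᵖ] :
    IsNoetherian Rᵐᵒᵖ R :=
  let e : Rᵐᵒᵖ ≃ₗ[Rᵐᵒᵖ] R :=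
    { MulOpposite.opAddEquiv.symm with
      map_smul' := fun _ _ => rfl }
  isNoetherian_of_linearEquiv e

variable {K G A : Type*} [Field K] [AddCommGroup G] [DecidableEq G] [Ring A] [Algebra K A]

theorem IsGradedLeftNoetherian.of_isNoetherianRing (𝒜 : G → Submodule K A) [GradedAlgebra 𝒜]
    [IsNoetherianRing A] : IsGradedLeftNoetherian 𝒜 :=
  fun I _ => monotone_stabilizes_iff_noetherian.2 ‹_› I

theorem IsGradedRightNoetherian.of_isNoetherianRing_mulOpposite (𝒜 : G → Submodule K A)
    [GradedAlgebra 𝒜] [IsNoetherianRing Aᵐᵒᵖ] : IsGradedRightNoetherian 𝒜 :=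
  fun I _ => monotone_stabilizes_iff_noetherian.2 (isNoetherian_mulOpposite A) I

end GradedNoetherian

section Coaction

open DirectSum

variable {R A G : Type*} [CommSemiring R] [Semiring A] [Algebra R A] [AddMonoid G] [DecidableEq G]

theorem isInternal_of_coaction (𝒜 : G → Submodule R A) [SetLike.GradedMonoid 𝒜] {s : Set A}
    (hs : ∀ a ∈ s, SetLike.IsHomogeneousElem 𝒜 a) (hgen : Algebra.adjoin R s = ⊤)
    (δ : A →ₗ[R] AddMonoidAlgebra A G)
    (hδ : ∀ g, ∀ a ∈ 𝒜 g, δ a = AddMonoidAlgebra.single g a) :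
    DirectSum.IsInternal 𝒜 := by
  have hcoeff : ∀ (x : ⨁ g, 𝒜 g) (g : G), (δ (DirectSum.coeAlgHom 𝒜 x)).coeff g = x g := by
    intro x g
    induction x using DirectSum.induction_on with
    | zero => simp
    | of h a =>
      rw [DirectSum.coeAlgHom_of, hδ h a a.2, DirectSum.coe_of_apply,
        AddMonoidAlgebra.coeff_single, Finsupp.single_apply]
      split_ifs <;> rfl
    | add x y hx hy => simp [hx, hy]
  have hrange : (DirectSum.coeAlgHom 𝒜).range = ⊤ := by
    refine top_le_iff.1 (hgen ▸ Algebra.adjoin_le fun a ha => ?_)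
    obtain ⟨g, hg⟩ := hs a ha
    exact ⟨DirectSum.of _ g ⟨a, hg⟩, DirectSum.coeAlgHom_of _ _ _⟩
  refine ⟨fun x y hxy => ?_, (AlgHom.range_eq_top _).1 hrange⟩
  ext g
  rw [← hcoeff x g, ← hcoeff y g]
  exact congrArg (fun a => (δ a).coeff g) hxy

end Coaction

section Enveloping

variable {K G L : Type*} [Field K] [AddCommGroup G] [DecidableEq G] {ε : G → G → Kˣ}
  [AddCommGroup L] [Module K L] (𝔏 : ColorLieAlgebra ε L) (ω : ColorTwoCocycle 𝔏)

instance tensorGrading_gradedMonoid : SetLike.GradedMonoid (tensorGrading 𝔏) where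
  one_mem := Submodule.subset_span ⟨[], by simp⟩
  mul_mem g h a b ha hb := by
    have := Submodule.mul_mem_mul ha hb
    rw [tensorGrading, tensorGrading, Submodule.span_mul_span] at this
    refine Submodule.span_mono ?_ this
    rintro _ ⟨_, ⟨l, hl, rfl, rfl⟩, _, ⟨l', hl', rfl, rfl⟩, rfl⟩
    exact ⟨l ++ l', fun p hp => (List.mem_append.1 hp).elim (hl p) (hl' p), by simp, by simp⟩

theorem ι_mem_tensorGrading {g : G} {a : L} (ha : a ∈ 𝔏.comp g) :
    TensorAlgebra.ι K a ∈ tensorGrading 𝔏 g :=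
  Submodule.subset_span ⟨[(g, a)], by simpa using ha, by simp, by simp⟩

instance genEnvelopingGrading_gradedMonoid :
    SetLike.GradedMonoid (genEnvelopingGrading 𝔏 ω) where
  one_mem := ⟨1, SetLike.one_mem_graded _, map_one (RingQuot.mkAlgHom K _)⟩
  mul_mem := by
    rintro g h _ _ ⟨a, ha, rfl⟩ ⟨b, hb, rfl⟩
    exact ⟨a * b, SetLike.mul_mem_graded ha hb, map_mul (RingQuot.mkAlgHom K _) a b⟩

namespace GenEnveloping

/-- The canonical map from `L` to its generalized enveloping algebra. -/
noncomputable def ofLie : L →ₗ[K] GenEnveloping 𝔏 ω :=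
  (RingQuot.mkAlgHom K (GenEnvelopingRel 𝔏 ω)).toLinearMap ∘ₗ TensorAlgebra.ι K

theorem ofLie_mem {g : G} {a : L} (ha : a ∈ 𝔏.comp g) :
    ofLie 𝔏 ω a ∈ genEnvelopingGrading 𝔏 ω g :=
  Submodule.mem_map_of_mem (ι_mem_tensorGrading 𝔏 ha)

theorem ofLie_mul_ofLie {g h : G} {a b : L} (ha : a ∈ 𝔏.comp g) (hb : b ∈ 𝔏.comp h) :
    ofLie 𝔏 ω a * ofLie 𝔏 ω b = (ε g h : K) • (ofLie 𝔏 ω b * ofLie 𝔏 ω a)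
      + ofLie 𝔏 ω (𝔏.bracket a b) + algebraMap K _ (ω.form a b) := by
  have hrel := RingQuot.mkAlgHom_rel K (GenEnvelopingRel.mk (ω := ω) ha hb)
  rw [map_zero, map_sub, map_sub, map_sub, sub_sub, sub_sub, sub_eq_zero, ← add_assoc] at hrel
  simpa [ofLie] using hrel

theorem adjoin_ofLie_image {s : Set L} (hs : Submodule.span K s = ⊤) :
    Algebra.adjoin K (ofLie 𝔏 ω '' s) = ⊤ := by
  have htensor : Algebra.adjoin K (TensorAlgebra.ι K '' s) = ⊤ := by
    rw [eq_top_iff, ← TensorAlgebra.adjoin_range_ι, Algebra.adjoin_le_iff, ← Set.image_univ,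
      ← Submodule.top_coe (R := K), ← hs, ← Submodule.map_coe, Submodule.map_span]
    exact Algebra.span_le_adjoin K _
  rw [ofLie, LinearMap.coe_comp, Set.image_comp, AlgHom.coe_toLinearMap, ← AlgHom.map_adjoin,
    htensor, Algebra.map_top, AlgHom.range_eq_top]
  exact RingQuot.mkAlgHom_surjective K _

theorem adjoin_range_ofLie_basis {σ : Type*} (b : Module.Basis σ K L) :
    Algebra.adjoin K (Set.range fun i => ofLie 𝔏 ω (b i)) = ⊤ := by
  simpa only [← Set.range_comp, Function.comp_def] using adjoin_ofLie_image 𝔏 ω b.span_eq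

open AddMonoidAlgebra in
/-- The linear map `L → U_ω(L)[G]` that extends to `coaction`: it sends `a ∈ L_g` to `a • g`. -/
noncomputable def coactionLie : L →ₗ[K] AddMonoidAlgebra (GenEnveloping 𝔏 ω) G :=
  DirectSum.toModule K G _ (fun g => lsingle g ∘ₗ ofLie 𝔏 ω ∘ₗ (𝔏.comp g).subtype) ∘ₗ
    (LinearEquiv.ofBijective (DirectSum.coeLinearMap 𝔏.comp) 𝔏.isInternal).symm.toLinearMap

theorem coactionLie_of_mem {g : G} {a : L} (ha : a ∈ 𝔏.comp g) :
    coactionLie 𝔏 ω a = AddMonoidAlgebra.single g (ofLie 𝔏 ω a) := by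
  have h : (LinearEquiv.ofBijective (DirectSum.coeLinearMap 𝔏.comp) 𝔏.isInternal).symm a =
      DirectSum.lof K G (fun g => 𝔏.comp g) g ⟨a, ha⟩ := by
    rw [LinearEquiv.symm_apply_eq]
    exact (DirectSum.coeLinearMap_lof 𝔏.comp g ⟨a, ha⟩).symm
  simp [coactionLie, h]

theorem coactionLie_mul_coactionLie {g h : G} {a b : L} (ha : a ∈ 𝔏.comp g)
    (hb : b ∈ 𝔏.comp h) :
    coactionLie 𝔏 ω a * coactionLie 𝔏 ω b = (ε g h : K) • (coactionLie 𝔏 ω b * coactionLie 𝔏 ω a)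
      + coactionLie 𝔏 ω (𝔏.bracket a b) + algebraMap K _ (ω.form a b) := by
  have hω : algebraMap K (AddMonoidAlgebra (GenEnveloping 𝔏 ω) G) (ω.form a b) =
      AddMonoidAlgebra.single (g + h) (algebraMap K _ (ω.form a b)) := by
    by_cases hgh : g + h = 0
    · rw [hgh]
      rfl
    · simp [ω.degree_zero ha hb hgh]
  rw [coactionLie_of_mem 𝔏 ω ha, coactionLie_of_mem 𝔏 ω hb,
    coactionLie_of_mem 𝔏 ω (𝔏.bracket_mem ha hb), hω, AddMonoidAlgebra.single_mul_single,
    AddMonoidAlgebra.single_mul_single, add_comm h g, AddMonoidAlgebra.smul_single,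
    ← AddMonoidAlgebra.single_add, ← AddMonoidAlgebra.single_add, ofLie_mul_ofLie 𝔏 ω ha hb]

/-- The algebra map `U_ω(L) → U_ω(L)[G]` that records the degree of a homogeneous element: the
coaction of the group algebra of `G` that corresponds to the grading. -/
noncomputable def coaction : GenEnveloping 𝔏 ω →ₐ[K] AddMonoidAlgebra (GenEnveloping 𝔏 ω) G :=
  RingQuot.liftAlgHom K ⟨TensorAlgebra.lift K (coactionLie 𝔏 ω), by
    rintro _ _ ⟨ha, hb⟩
    simp only [map_sub, map_mul, map_smul, map_zero, TensorAlgebra.lift_ι_apply,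
      AlgHom.commutes, coactionLie_mul_coactionLie 𝔏 ω ha hb]
    abel⟩

theorem coaction_mkAlgHom_ι {g : G} {a : L} (ha : a ∈ 𝔏.comp g) :
    coaction 𝔏 ω (RingQuot.mkAlgHom K _ (TensorAlgebra.ι K a)) =
      AddMonoidAlgebra.single g (RingQuot.mkAlgHom K _ (TensorAlgebra.ι K a)) := by
  simp [coaction, coactionLie_of_mem 𝔏 ω ha, ofLie]

theorem coaction_of_mem {g : G} {u : GenEnveloping 𝔏 ω} (hu : u ∈ genEnvelopingGrading 𝔏 ω g) :
    coaction 𝔏 ω u = AddMonoidAlgebra.single g u := by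
  suffices genEnvelopingGrading 𝔏 ω g ≤
      LinearMap.eqLocus (coaction 𝔏 ω).toLinearMap (AddMonoidAlgebra.lsingle g) from this hu
  rw [genEnvelopingGrading, tensorGrading, Submodule.map_span_le]
  rintro _ ⟨l, hl, rfl, rfl⟩
  change coaction 𝔏 ω (RingQuot.mkAlgHom K _ _) =
    AddMonoidAlgebra.single _ (RingQuot.mkAlgHom K _ _)
  clear hu
  induction l with
  | nil => simp [AddMonoidAlgebra.one_def]
  | cons p l ih =>
    have hp := coaction_mkAlgHom_ι 𝔏 ω (hl p List.mem_cons_self)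
    have hl := ih fun q hq => hl q (List.mem_cons_of_mem p hq)
    simp only [List.map_cons, List.prod_cons, List.sum_cons, map_mul, hp, hl,
      AddMonoidAlgebra.single_mul_single]

theorem isInternal_grading : DirectSum.IsInternal (genEnvelopingGrading 𝔏 ω) := by
  have hspan : Submodule.span K (⋃ g, (𝔏.comp g : Set L)) = ⊤ := by
    rw [Submodule.span_iUnion, ← 𝔏.isInternal.submodule_iSup_eq_top]
    simp only [Submodule.span_eq]
  refine isInternal_of_coaction _ ?_ (adjoin_ofLie_image 𝔏 ω hspan) (coaction 𝔏 ω).toLinearMap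
    fun _ _ ha => coaction_of_mem 𝔏 ω ha
  rintro _ ⟨a, ha, rfl⟩
  obtain ⟨g, hg⟩ := Set.mem_iUnion.1 ha
  exact ⟨g, ofLie_mem 𝔏 ω hg⟩

noncomputable instance gradedAlgebra : GradedAlgebra (genEnvelopingGrading 𝔏 ω) where
  toDecomposition := (isInternal_grading 𝔏 ω).chooseDecomposition

theorem isSkewCommuting_of_basis {σ : Type*} (b : Module.Basis σ K L) (deg : σ → G)
    (hb : ∀ i, b i ∈ 𝔏.comp (deg i)) : IsSkewCommuting K fun i => ofLie 𝔏 ω (b i) := by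
  intro i j
  refine ⟨ε (deg i) (deg j), ?_⟩
  rw [ofLie_mul_ofLie 𝔏 ω (hb i) (hb j), add_assoc, add_sub_cancel_left]
  refine add_mem (Submodule.span_mono (Set.subset_insert _ _) ?_) ?_
  · have := Submodule.mem_map_of_mem (f := ofLie 𝔏 ω) (b.mem_span (𝔏.bracket (b i) (b j)))
    rwa [Submodule.map_span, ← Set.range_comp] at this
  · rw [Algebra.algebraMap_eq_smul_one]
    exact Submodule.smul_mem _ _ (Submodule.subset_span (Set.mem_insert _ _))

end GenEnveloping

end Enveloping

theorem proposition2p4_general {K G L : Type*} [Field K] [AddCommGroup G] [DecidableEq G]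
    [AddCommGroup L] [Module K L] [FiniteDimensional K L] {ε : G → G → Kˣ}
    (𝔏 : ColorLieAlgebra ε L) (ω : ColorTwoCocycle 𝔏) :
    ∃ _ : GradedAlgebra (genEnvelopingGrading 𝔏 ω),
      IsGradedLeftNoetherian (genEnvelopingGrading 𝔏 ω) ∧
      IsGradedRightNoetherian (genEnvelopingGrading 𝔏 ω) ∧
      IsNoetherianRing (GenEnveloping 𝔏 ω) ∧
      IsNoetherianRing (GenEnveloping 𝔏 ω)ᵐᵒᵖ := by
  let b := 𝔏.isInternal.collectedBasis fun g => Module.Free.chooseBasis K (𝔏.comp g)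
  have hb := 𝔏.isInternal.collectedBasis_mem fun g => Module.Free.chooseBasis K (𝔏.comp g)
  have := Module.Finite.finite_basis b
  have hx := GenEnveloping.isSkewCommuting_of_basis 𝔏 ω b Sigma.fst hb
  have hgen := GenEnveloping.adjoin_range_ofLie_basis 𝔏 ω b
  have hleft := hx.isNoetherianRing hgen
  have hright := hx.isNoetherianRing_mulOpposite hgen
  exact ⟨GenEnveloping.gradedAlgebra 𝔏 ω, .of_isNoetherianRing _,
    .of_isNoetherianRing_mulOpposite _, hleft, hright⟩

theorem proposition2p4 {K G L : Type*} [Field K] [CharZero K] [AddCommGroup G] [DecidableEq G]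
    [AddCommGroup L] [Module K L] [FiniteDimensional K L]
    (ε : G → G → Kˣ) (hε : IsAntiBicharacter ε)
    (𝔏 : ColorLieAlgebra ε L) (ω : ColorTwoCocycle 𝔏) :
    ∃ _ : GradedAlgebra (genEnvelopingGrading 𝔏 ω),
      IsGradedLeftNoetherian (genEnvelopingGrading 𝔏 ω) ∧
      IsGradedRightNoetherian (genEnvelopingGrading 𝔏 ω) ∧
      IsNoetherianRing (GenEnveloping 𝔏 ω) ∧
      IsNoetherianRing (GenEnveloping 𝔏 ω)ᵐᵒᵖ :=
  proposition2p4_general 𝔏 ω
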